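/- Let $K$ be a commutative ring containing $\mathbb{Q}$ (i.e. a commutative $\mathbb{Q}$-algebra), let $\mathfrak g$ be a Lie $K$-algebra with universal enveloping algebra $\mathcal U\mathfrak g$, and let $m:\bigotimes\mathfrak g\to\mathcal U\mathfrak g$ be the canonical homomorphism from the tensor algebra, so that $m(x_1\otimes\cdots\otimes x_n)=x_1\cdots x_n$. Regard elements of $\mathfrak g$ as elements of $\mathcal U\mathfrak g$ through the canonical map $\mathfrak g\to\mathcal U\mathfrak g$. Write $$[x_1,\ldots,x_p]_{\mathrm L}=[x_1,[x_2,\ldots,[x_{p-1},x_p]\ldots]],\qquad [x_1,\ldots,x_p]_{\mathrm R}=[[\ldots[x_1,x_2],\ldots,x_{p-1}],x_p]$$ for the left- and right-iterated Lie brackets, with $[x]_{\mathrm L}=[x]_{\mathrm R}=x$. Let $n$ be a natural number and let $W\subset\bigotimes^n\mathfrak g$ be a $K$-submodule which is closed under the action of the symmetric group $\Sigma_n$ permuting the tensor factors, and such that the restriction $m|_W:W\to\mathcal U\mathfrak g$ is injective. If $$P=\sum_{\lambda}a_{1,\lambda}\otimes\cdots\otimes a_{n,\lambda}\qquad\text{(a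 finite sum, } a_{i,\lambda}\in\mathfrak g)$$ satisfies $P\in W$ and $m(P)\in\mathfrak g$, then in $\mathcal U\mathfrak g$ $$n(n-1)\cdot m(P)=\sum_{\lambda}\sum_{p=1}^{n-1}\bigl[[a_{1,\lambda},\ldots,a_{p,\lambda}]_{\mathrm L},\,[a_{p+1,\lambda},\ldots,a_{n,\lambda}]_{\mathrm R}\bigr].$$ -/

import Mathlib

open scoped TensorProduct

/-- Left-iterated bracket `[x₁, …, xₙ]_L = [x₁, [x₂, …, [xₙ₋₁, xₙ]…]]`, with `[x₁]_L = x₁`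
(and the value `0` for the empty list, which never occurs below). -/
def lieBracketL {L : Type*} [LieRing L] : List L → L
  | [] => 0
  | [x] => x
  | x :: y :: l => ⁅x, lieBracketL (y :: l)⁆

/-- Right-iterated bracket `[x₁, …, xₙ]_R = [[…[x₁, x₂], …, xₙ₋₁], xₙ]`, with `[x₁]_R = x₁`
(and the value `0` for the empty list, which never occurs below). -/
def lieBracketR {L : Type*} [LieRing L] : List L → L
  | [] => 0
  | x :: l => l.foldl (fun u v => ⁅u, v⁆) x

/-- The restriction to the `n`-th tensor power `⨂ⁿ 𝔤` of the canonical homomorphism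
`m : ⨂ 𝔤 → 𝒰 𝔤` from the tensor algebra to the universal enveloping algebra;
it sends `x₁ ⊗ ⋯ ⊗ xₙ` to the product `x₁ ⋯ xₙ`. -/
noncomputable def tensorPowerToEnveloping (K : Type*) [CommRing K] (𝔤 : Type*) [LieRing 𝔤]
    [LieAlgebra K 𝔤] (n : ℕ) : (⨂[K]^n 𝔤) →ₗ[K] UniversalEnvelopingAlgebra K 𝔤 :=
  (UniversalEnvelopingAlgebra.mkAlgHom K 𝔤).toLinearMap ∘ₗ TensorPower.toTensorAlgebra

section FreeLieElements

attribute [local instance] LieRing.ofAssociativeRing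

/-! Two facts about the tensor algebra `T` of `𝔤` carry the proof: the image `w` of `P` in `T` is a
Lie element, and on Lie elements the cut-and-bracket operator equals `D (D - 1)`, with `D` the Euler
derivation. As `D w = n w`, applying the projection to the enveloping algebra gives the formula.

For the first fact, let `ψ` be the second Adams operation, the unshuffle coproduct followed by
multiplication. On degree `n` it is a sum of permutations, so it preserves `W`; it is compatible
with the corresponding operation on the enveloping algebra, which doubles elements of `𝔤`.
Injectivity on `W` therefore lifts `m(P) ∈ 𝔤` to `ψ w = 2 w`. Over `ℚ`, `T` is spanned by powers `y
^ k` of Lie elements, on which `ψ` is `2 ^ k`, so the eigenvalue `2` singles out Lie elements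
(`mem_lieElements_of_adamsTwo_eq`).

The second fact (`commutator_splitBracket_of_mem_lieElements`) is an induction over brackets, based
on how iterated brackets of a product `u * s` of Lie elements decompose. -/

/-! ### Polarization over `ℚ` -/

theorem Submodule.mem_of_forall_nat_sum_pow_smul_mem {M : Type*} [AddCommGroup M] [Module ℚ M]
    (S : Submodule ℚ M) (d : ℕ) (c : ℕ → M)
    (h : ∀ t : ℕ, ∑ i ∈ Finset.range d, (t : ℚ) ^ i • c i ∈ S) : ∀ i < d, c i ∈ S := by
  induction d generalizing c with
  | zero => simp
  | succ d ih =>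
    have hlt : ∀ i < d, c i ∈ S := by
      intro i hi
      -- With `f` the given sum, `f (2 t) - 2 ^ d f t` has no term of degree `d`, and its other
      -- coefficients are nonzero rational multiples of those of `f`.
      have key := ih (fun i => ((2 : ℚ) ^ i - 2 ^ d) • c i) (fun t => by
        have h1 := S.sub_mem (h (2 * t)) (S.smul_mem ((2 : ℚ) ^ d) (h t))
        convert h1 using 1
        rw [Finset.sum_range_succ, Finset.sum_range_succ, smul_add, Finset.smul_sum,
          add_sub_add_comm, ← Finset.sum_sub_distrib, smul_smul, ← sub_smul]
        have : ((2 * t : ℕ) : ℚ) ^ d - 2 ^ d * (t : ℚ) ^ d = 0 := by push_cast; ring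
        rw [this, zero_smul, add_zero]
        refine Finset.sum_congr rfl fun i _ => ?_
        rw [smul_smul, smul_smul, ← sub_smul]
        congr 1
        push_cast
        ring) i hi
      refine (S.smul_mem_iff ?_).1 key
      have : (2 : ℚ) ^ i < 2 ^ d := pow_lt_pow_right₀ (by norm_num) hi
      exact (sub_neg.2 this).ne
    intro i hi
    rcases Nat.lt_succ_iff_lt_or_eq.1 hi with hi | rfl
    · exact hlt i hi
    · have h1 := h 1
      rw [Finset.sum_range_succ] at h1
      have h2 := (S.add_mem_iff_right (S.sum_mem fun j hj =>
        S.smul_mem _ (hlt j (Finset.mem_range.1 hj)))).1 h1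
      simpa using h2

theorem Polynomial.coeff_mem_of_forall_eval_natCast_mem {A : Type*} [Ring A] [Algebra ℚ A]
    (S : Submodule ℚ A) (p : Polynomial A) (h : ∀ t : ℕ, p.eval (t : A) ∈ S) (i : ℕ) :
    p.coeff i ∈ S := by
  by_cases hi : i < p.natDegree + 1
  · refine S.mem_of_forall_nat_sum_pow_smul_mem (p.natDegree + 1) p.coeff (fun t => ?_) i hi
    convert h t using 1
    rw [Polynomial.eval_eq_sum_range]
    refine Finset.sum_congr rfl fun j _ => ?_
    rw [Algebra.smul_def, map_pow, map_natCast]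
    exact ((Nat.cast_commute t _).pow_left j).eq
  · rw [Polynomial.coeff_eq_zero_of_natDegree_lt (by omega)]
    exact S.zero_mem

theorem Polynomial.coeff_one_C_add_X_mul_C_pow {A : Type*} [Ring A] (x y : A) (N : ℕ) :
    ((Polynomial.C y + Polynomial.X * Polynomial.C x) ^ N).coeff 1 =
      ∑ i ∈ Finset.range N, y ^ i * x * y ^ (N - 1 - i) := by
  induction N with
  | zero => simp [Polynomial.coeff_one]
  | succ N ih =>
    have h0 : ((Polynomial.C y + Polynomial.X * Polynomial.C x) ^ N).coeff 0 = y ^ N := by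
      rw [← Polynomial.constantCoeff_apply, map_pow]
      simp
    rw [pow_succ, Polynomial.mul_coeff_one, ih, h0, Finset.sum_range_succ, add_comm]
    congr 1
    · have : (Polynomial.C y + Polynomial.X * Polynomial.C x).coeff 0 = y := by simp
      rw [this, Finset.sum_mul]
      refine Finset.sum_congr rfl fun i hi => ?_
      have hi := Finset.mem_range.1 hi
      rw [mul_assoc, ← pow_succ]
      congr 2
      omega
    · simp [Polynomial.coeff_C]

/-! ### Powers of Lie elements and their eigenvalues -/

section PowersOfLieElements

variable {K A : Type*} [CommRing K] [Ring A] [Algebra K A]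

/-- The span of all powers of the elements of a Lie subalgebra of an associative algebra. -/
def LieSubalgebra.powerSpan (L : LieSubalgebra K A) : Submodule K A :=
  Submodule.span K {a | ∃ y ∈ L, ∃ k : ℕ, a = y ^ k}

theorem LieSubalgebra.pow_mem_powerSpan (L : LieSubalgebra K A) {y : A} (hy : y ∈ L) (k : ℕ) :
    y ^ k ∈ L.powerSpan :=
  Submodule.subset_span ⟨y, hy, k, rfl⟩

variable [Algebra ℚ K] [Algebra ℚ A] [IsScalarTower ℚ K A]

/-- Moving `x` past one `y` costs a term with `⁅x, y⁆` in place of `x` and one `y` fewer, which lies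
in the span by induction. So all positions of `x` agree modulo the span, while their sum is the
linear coefficient of `(y + t x) ^ N`, in the span by polarization; dividing by `N` finishes. -/
theorem LieSubalgebra.pow_mul_mul_pow_mem_powerSpan (L : LieSubalgebra K A) (k : ℕ) :
    ∀ x ∈ L, ∀ y ∈ L, ∀ i j : ℕ, i + j = k → y ^ i * x * y ^ j ∈ L.powerSpan := by
  induction k with
  | zero =>
    intro x hx y _ i j hij
    obtain ⟨rfl, rfl⟩ : i = 0 ∧ j = 0 := by omega
    simpa using L.pow_mem_powerSpan hx 1
  | succ k ih =>
    intro x hx y hy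
    have hstep : ∀ i j : ℕ, i + j = k + 1 →
        x * y ^ (k + 1) - y ^ i * x * y ^ j ∈ L.powerSpan := by
      intro i
      induction i with
      | zero =>
        intro j hj
        obtain rfl : j = k + 1 := by omega
        simp
      | succ i ihi =>
        intro j hj
        have h1 := ihi (j + 1) (by omega)
        have h2 := ih ⁅x, y⁆ (L.lie_mem hx hy) y hy i j (by omega)
        convert L.powerSpan.add_mem h1 h2 using 1
        rw [LieRing.of_associative_ring_bracket, pow_succ' y j, pow_succ y i]
        noncomm_ring
    have hsum : ∑ i ∈ Finset.range (k + 2), y ^ i * x * y ^ (k + 2 - 1 - i) ∈ L.powerSpan := by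
      rw [← Polynomial.coeff_one_C_add_X_mul_C_pow]
      refine Polynomial.coeff_mem_of_forall_eval_natCast_mem (L.powerSpan.restrictScalars ℚ) _
        (fun t => ?_) 1
      have : ((Polynomial.C y + Polynomial.X * Polynomial.C x) ^ (k + 2)).eval (t : A) =
          (y + (t : K) • x) ^ (k + 2) := by
        -- Evaluation is multiplicative here because natural numbers are central, although `A` need
        -- not be commutative.
        have hc : ∀ q : Polynomial A, q.eval (t : A) =
            Polynomial.eval₂RingHom' (RingHom.id A) (t : A) (fun a => Nat.commute_cast a t) q :=
          fun q => rfl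
        rw [hc, map_pow, ← hc]
        simp [Algebra.smul_def, (Nat.cast_commute t x).eq]
      rw [this]
      exact L.pow_mem_powerSpan (L.add_mem hy (L.smul_mem _ hx)) _
    have hx0 : x * y ^ (k + 1) ∈ L.powerSpan.restrictScalars ℚ := by
      refine ((L.powerSpan.restrictScalars ℚ).smul_mem_iff
        (show ((k : ℚ) + 2) ≠ 0 by positivity)).1 ?_
      have h1 : ∑ i ∈ Finset.range (k + 2),
          (x * y ^ (k + 1) - y ^ i * x * y ^ (k + 2 - 1 - i)) ∈ L.powerSpan :=
        L.powerSpan.sum_mem fun i hi => hstep i _ (by have := Finset.mem_range.1 hi; omega)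
      have h2 := L.powerSpan.add_mem h1 hsum
      rw [← Finset.sum_add_distrib] at h2
      simp only [sub_add_cancel, Finset.sum_const, Finset.card_range] at h2
      rw [← Nat.cast_smul_eq_nsmul ℚ] at h2
      simpa using h2
    intro i j hij
    exact (L.powerSpan.sub_mem_iff_right hx0).1 (hstep i j hij)

theorem LieSubalgebra.mul_mem_powerSpan (L : LieSubalgebra K A) {x a : A} (hx : x ∈ L)
    (ha : a ∈ L.powerSpan) : x * a ∈ L.powerSpan := by
  induction ha using Submodule.span_induction with
  | mem a ha =>
    obtain ⟨y, hy, k, rfl⟩ := ha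
    simpa using L.pow_mul_mul_pow_mem_powerSpan k x hx y hy 0 k (by omega)
  | zero => simp
  | add a b _ _ ha hb => rw [mul_add]; exact add_mem ha hb
  | smul c a _ ha => rw [mul_smul_comm]; exact Submodule.smul_mem _ c ha

/-- If a linear endomorphism multiplies the `k`-th powers of Lie elements by `2 ^ k`, then its
eigenvectors of eigenvalue `2` in the span of these powers are Lie elements. -/
theorem LieSubalgebra.mem_of_mem_powerSpan_of_apply_eq_two_smul (L : LieSubalgebra K A)
    (f : A →ₗ[K] A) (hf : ∀ y ∈ L, ∀ k : ℕ, f (y ^ k) = (2 ^ k : ℕ) • y ^ k) {p : A}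
    (hp : p ∈ L.powerSpan) (hfp : f p = (2 : ℕ) • p) : p ∈ L := by
  -- Eigenspaces are taken over `ℚ`, since independence may fail over a ring `K` with zero divisors.
  let F : Module.End ℚ A := f.restrictScalars ℚ
  have hmem : ∀ a : A, ∀ k : ℕ, a ∈ F.eigenspace (2 ^ k) ↔ f a = (2 ^ k : ℕ) • a := by
    intro a k
    rw [Module.End.mem_eigenspace_iff, ← Nat.cast_smul_eq_nsmul ℚ]
    push_cast
    rfl
  have hdec : ∃ q ∈ L, p - q ∈ ⨆ (μ : ℚ) (_ : μ ≠ 2), F.eigenspace μ := by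
    clear hfp
    -- Only multiples `c • y ^ k` of generators need treatment: the sum of rational eigenspaces is
    -- not given as a `K`-submodule.
    induction hp using Submodule.closure_induction with
    | zero => exact ⟨0, L.zero_mem, by simp⟩
    | add a b _ _ ha hb =>
      obtain ⟨q, hq, h⟩ := ha
      obtain ⟨q', hq', h'⟩ := hb
      refine ⟨q + q', L.add_mem hq hq', ?_⟩
      rw [add_sub_add_comm]
      exact add_mem h h'
    | smul_mem c a ha =>
      obtain ⟨y, hy, k, rfl⟩ := ha
      by_cases hk : k = 1
      · subst hk
        exact ⟨c • y, L.smul_mem c hy, by simp⟩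
      · refine ⟨0, L.zero_mem, ?_⟩
        rw [sub_zero]
        have h2 : (2 : ℚ) ^ k ≠ 2 := fun h =>
          hk (pow_right_injective₀ (by norm_num) (by norm_num) (h.trans (pow_one _).symm))
        refine Submodule.mem_iSup_of_mem _ (Submodule.mem_iSup_of_mem h2 ?_)
        rw [hmem, map_smul, hf y hy, smul_comm]
  obtain ⟨q, hq, h⟩ := hdec
  have hpq : p - q ∈ F.eigenspace 2 := by
    have := (hmem (p - q) 1).2 (by
      have := hf q hq 1
      rw [pow_one, pow_one] at this
      rw [map_sub, hfp, this, pow_one, smul_sub])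
    simpa using this
  have h0 := (Submodule.disjoint_def.1 (F.eigenspaces_iSupIndep 2)) _ hpq h
  rw [sub_eq_zero.1 h0]
  exact hq

end PowersOfLieElements

/-! ### Lie elements and the Adams operation of the tensor algebra -/

namespace TensorAlgebra

variable {K V : Type*} [CommRing K] [AddCommGroup V] [Module K V]

/-- Induction on words, adding letters on the left. -/
theorem eq_top_of_one_mem_of_ι_mul_mem (S : Submodule K (TensorAlgebra K V)) (h1 : 1 ∈ S)
    (hmul : ∀ v, ∀ u ∈ S, ι K v * u ∈ S) : S = ⊤ := by
  refine (Submodule.eq_top_iff').2 fun u => ?_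
  suffices h : ∀ s ∈ S, u * s ∈ S by simpa using h 1 h1
  induction u using TensorAlgebra.induction with
  | algebraMap r => intro s hs; rw [← Algebra.smul_def]; exact S.smul_mem r hs
  | ι v => exact hmul v
  | mul a b ha hb => intro s hs; rw [mul_assoc]; exact ha _ (hb s hs)
  | add a b ha hb => intro s hs; rw [add_mul]; exact S.add_mem (ha s hs) (hb s hs)

variable (K V) in
/-- The Lie elements of the tensor algebra. -/
def lieElements : LieSubalgebra K (TensorAlgebra K V) :=
  LieSubalgebra.lieSpan K _ (Set.range (ι K))

theorem ι_mem_lieElements (v : V) : ι K v ∈ lieElements K V :=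
  LieSubalgebra.subset_lieSpan ⟨v, rfl⟩

theorem powerSpan_lieElements [Algebra ℚ K] [Module ℚ V] [IsScalarTower ℚ K V] :
    (lieElements K V).powerSpan = ⊤ :=
  eq_top_of_one_mem_of_ι_mul_mem _
    (by simpa using (lieElements K V).pow_mem_powerSpan (LieSubalgebra.zero_mem _) 0)
    fun v _ hu => (lieElements K V).mul_mem_powerSpan (ι_mem_lieElements v) hu

variable (K V) in
/-- The unshuffle coproduct of the tensor algebra. -/
noncomputable def unshuffle : TensorAlgebra K V →ₐ[K] TensorAlgebra K V ⊗[K] TensorAlgebra K V :=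
  lift K ((TensorProduct.mk K (TensorAlgebra K V) (TensorAlgebra K V)).flip 1 ∘ₗ ι K +
    TensorProduct.mk K (TensorAlgebra K V) (TensorAlgebra K V) 1 ∘ₗ ι K)

theorem unshuffle_ι (v : V) : unshuffle K V (ι K v) = ι K v ⊗ₜ[K] 1 + 1 ⊗ₜ[K] ι K v := by
  simp [unshuffle]

theorem unshuffle_of_mem_lieElements {y : TensorAlgebra K V} (hy : y ∈ lieElements K V) :
    unshuffle K V y = y ⊗ₜ[K] 1 + 1 ⊗ₜ[K] y := by
  induction hy using LieSubalgebra.lieSpan_induction with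
  | mem x h => obtain ⟨v, rfl⟩ := h; exact unshuffle_ι v
  | zero => simp
  | add x y _ _ hx hy => rw [map_add, hx, hy, TensorProduct.add_tmul, TensorProduct.tmul_add]; abel
  | smul c x _ hx => rw [map_smul, hx, smul_add, TensorProduct.smul_tmul', TensorProduct.tmul_smul]
  | lie x y _ _ hx hy =>
    rw [LieRing.of_associative_ring_bracket, map_sub, map_mul, map_mul, hx, hy]
    simp only [add_mul, mul_add, Algebra.TensorProduct.tmul_mul_tmul, mul_one, one_mul,
      TensorProduct.sub_tmul, TensorProduct.tmul_sub]
    abel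

variable (K V) in
/-- The second Adams operation of the tensor algebra. -/
noncomputable def adamsTwo : TensorAlgebra K V →ₗ[K] TensorAlgebra K V :=
  LinearMap.mul' K (TensorAlgebra K V) ∘ₗ (unshuffle K V).toLinearMap

/-- Lie elements are primitive, so the coproduct of `y ^ k` expands binomially and each term
multiplies back to `y ^ k`. -/
theorem adamsTwo_pow {y : TensorAlgebra K V} (hy : y ∈ lieElements K V) (k : ℕ) :
    adamsTwo K V (y ^ k) = (2 ^ k : ℕ) • y ^ k := by
  have hc : Commute (y ⊗ₜ[K] (1 : TensorAlgebra K V)) ((1 : TensorAlgebra K V) ⊗ₜ[K] y) := by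
    simp [Commute, SemiconjBy]
  rw [adamsTwo, LinearMap.comp_apply, AlgHom.toLinearMap_apply, map_pow,
    unshuffle_of_mem_lieElements hy, hc.add_pow, map_sum, ← Nat.sum_range_choose k, Finset.sum_smul]
  refine Finset.sum_congr rfl fun i hi => ?_
  have hi := Finset.mem_range.1 hi
  rw [← nsmul_eq_mul', map_nsmul]
  congr 1
  simp only [Algebra.TensorProduct.tmul_pow, one_pow, Algebra.TensorProduct.tmul_mul_tmul, one_mul,
    mul_one, LinearMap.mul'_apply]
  rw [← pow_add]
  congr 1
  omega

theorem mem_lieElements_of_adamsTwo_eq [Algebra ℚ K] [Module ℚ V] [IsScalarTower ℚ K V]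
    {p : TensorAlgebra K V} (hp : adamsTwo K V p = (2 : ℕ) • p) : p ∈ lieElements K V :=
  (lieElements K V).mem_of_mem_powerSpan_of_apply_eq_two_smul (adamsTwo K V)
    (fun _ hy k => adamsTwo_pow hy k) (by rw [powerSpan_lieElements]; trivial) hp

end TensorAlgebra

/-! ### The Adams operation as a sum of permutations -/

/-- All the ways of splitting a list into two complementary sublists. -/
def List.unshuffles {α : Type*} : List α → List (List α × List α)
  | [] => [([], [])]
  | i :: l => l.unshuffles.map (fun c => (i :: c.1, c.2)) ++ l.unshuffles.map fun c => (c.1, i :: c.2)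

theorem List.append_perm_of_mem_unshuffles {α : Type*} (l : List α) :
    ∀ c ∈ l.unshuffles, (c.1 ++ c.2).Perm l := by
  induction l with
  | nil => simp [List.unshuffles]
  | cons i l ih =>
    intro c hc
    simp only [List.unshuffles, List.mem_append, List.mem_map] at hc
    rcases hc with ⟨d, hd, rfl⟩ | ⟨d, hd, rfl⟩
    · exact (ih d hd).cons i
    · exact List.perm_middle.trans ((ih d hd).cons i)

namespace TensorAlgebra

variable {K V : Type*} [CommRing K] [AddCommGroup V] [Module K V]

theorem unshuffle_list_prod {α : Type*} (x : α → V) (l : List α) :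
    unshuffle K V (l.map fun i => ι K (x i)).prod =
      (l.unshuffles.map fun c =>
        (c.1.map fun i => ι K (x i)).prod ⊗ₜ[K] (c.2.map fun i => ι K (x i)).prod).sum := by
  induction l with
  | nil => simp [List.unshuffles, Algebra.TensorProduct.one_def]
  | cons i l ih =>
    rw [List.map_cons, List.prod_cons, map_mul, ih, unshuffle_ι, add_mul, ← List.sum_map_mul_left,
      ← List.sum_map_mul_left]
    simp [List.unshuffles, Function.comp_def]

theorem adamsTwo_list_prod {α : Type*} (x : α → V) (l : List α) :
    adamsTwo K V (l.map fun i => ι K (x i)).prod =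
      (l.unshuffles.map fun c => ((c.1 ++ c.2).map fun i => ι K (x i)).prod).sum := by
  rw [adamsTwo, LinearMap.comp_apply, AlgHom.toLinearMap_apply, unshuffle_list_prod,
    map_list_sum, List.map_map]
  simp [Function.comp_def]

theorem exists_perm_toTensorAlgebra_reindex {n : ℕ} (c : List (Fin n))
    (hc : c.Perm (List.finRange n)) :
    ∃ σ : Equiv.Perm (Fin n), ∀ x : Fin n → V,
      TensorPower.toTensorAlgebra
        (PiTensorProduct.reindex K (fun _ => V) σ (PiTensorProduct.tprod K x)) =
          (c.map fun i => ι K (x i)).prod := by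
  have hlen : c.length = n := by simpa using hc.length_eq
  have hnd : c.Nodup := hc.nodup_iff.2 (List.nodup_finRange n)
  have hinj : Function.Injective fun i : Fin n => c.get (i.cast hlen.symm) := fun i j hij => by
    simpa using List.nodup_iff_injective_get.1 hnd hij
  let τ : Equiv.Perm (Fin n) := Equiv.ofBijective _ (Finite.injective_iff_bijective.1 hinj)
  have hτ : c = List.ofFn τ := by
    refine List.ext_get (by simp [hlen]) fun i h1 h2 => ?_
    simp [τ]
  refine ⟨τ.symm, fun x => ?_⟩
  rw [PiTensorProduct.reindex_tprod, TensorPower.toTensorAlgebra_tprod, tprod_apply, hτ,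
    List.map_ofFn]
  rfl

theorem exists_end_toTensorAlgebra_eq_list_sum {n : ℕ} (C : List (List (Fin n)))
    (hC : ∀ c ∈ C, c.Perm (List.finRange n)) :
    ∃ ψ : Module.End K (⨂[K]^n V),
      (∀ W : Submodule K (⨂[K]^n V),
        (∀ σ : Equiv.Perm (Fin n), ∀ t ∈ W, PiTensorProduct.reindex K (fun _ => V) σ t ∈ W) →
          ∀ t ∈ W, ψ t ∈ W) ∧
      ∀ x : Fin n → V, TensorPower.toTensorAlgebra (ψ (PiTensorProduct.tprod K x)) =
        (C.map fun c => (c.map fun i => ι K (x i)).prod).sum := by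
  induction C with
  | nil => exact ⟨0, fun W _ t _ => W.zero_mem, fun x => by simp⟩
  | cons c C ih =>
    obtain ⟨ψ, h1, h2⟩ := ih fun d hd => hC d (List.mem_cons_of_mem _ hd)
    obtain ⟨σ, hσ⟩ := exists_perm_toTensorAlgebra_reindex (K := K) (V := V) c
      (hC c List.mem_cons_self)
    refine ⟨(PiTensorProduct.reindex K (fun _ => V) σ).toLinearMap + ψ, fun W hW t ht =>
      W.add_mem (hW σ t ht) (h1 W hW t ht), fun x => ?_⟩
    rw [List.map_cons, List.sum_cons, ← h2, ← hσ, ← map_add]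
    rfl

theorem exists_end_toTensorAlgebra_eq_adamsTwo (n : ℕ) :
    ∃ ψ : Module.End K (⨂[K]^n V),
      (∀ W : Submodule K (⨂[K]^n V),
        (∀ σ : Equiv.Perm (Fin n), ∀ t ∈ W, PiTensorProduct.reindex K (fun _ => V) σ t ∈ W) →
          ∀ t ∈ W, ψ t ∈ W) ∧
      ∀ t, TensorPower.toTensorAlgebra (ψ t) = adamsTwo K V (TensorPower.toTensorAlgebra t) := by
  obtain ⟨ψ, h1, h2⟩ := exists_end_toTensorAlgebra_eq_list_sum (K := K) (V := V)
    ((List.finRange n).unshuffles.map fun c => c.1 ++ c.2) (by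
      intro c hc
      obtain ⟨d, hd, rfl⟩ := List.mem_map.1 hc
      exact List.append_perm_of_mem_unshuffles _ d hd)
  refine ⟨ψ, h1, fun t => ?_⟩
  suffices h : TensorPower.toTensorAlgebra ∘ₗ ψ = adamsTwo K V ∘ₗ TensorPower.toTensorAlgebra from
    LinearMap.congr_fun h t
  refine PiTensorProduct.ext (MultilinearMap.ext fun x => ?_)
  simp only [LinearMap.compMultilinearMap_apply, LinearMap.comp_apply]
  rw [h2, TensorPower.toTensorAlgebra_tprod, tprod_apply, List.ofFn_eq_map,
    adamsTwo_list_prod, List.map_map]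
  rfl

end TensorAlgebra

/-! ### Descent of the coproduct to the enveloping algebra -/

namespace UniversalEnvelopingAlgebra

variable (K 𝔤 : Type*) [CommRing K] [LieRing 𝔤] [LieAlgebra K 𝔤]

/-- The coproduct of the universal enveloping algebra. -/
noncomputable def coproduct : UniversalEnvelopingAlgebra K 𝔤 →ₐ[K]
    UniversalEnvelopingAlgebra K 𝔤 ⊗[K] UniversalEnvelopingAlgebra K 𝔤 :=
  lift K
    { toFun x := ι K x ⊗ₜ[K] 1 + 1 ⊗ₜ[K] ι K x
      map_add' x y := by
        rw [map_add, TensorProduct.add_tmul, TensorProduct.tmul_add]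
        abel
      map_smul' c x := by
        rw [map_smul, ← TensorProduct.smul_tmul', TensorProduct.tmul_smul, ← smul_add]
        rfl
      map_lie' {x y} := by
        rw [LieHom.map_lie, LieRing.of_associative_ring_bracket,
          LieRing.of_associative_ring_bracket]
        simp only [add_mul, mul_add, Algebra.TensorProduct.tmul_mul_tmul, mul_one, one_mul,
          TensorProduct.sub_tmul, TensorProduct.tmul_sub]
        abel }

variable {𝔤}

theorem coproduct_ι (x : 𝔤) : coproduct K 𝔤 (ι K x) = ι K x ⊗ₜ[K] 1 + 1 ⊗ₜ[K] ι K x :=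
  lift_ι_apply K _ x

theorem coproduct_mkAlgHom (w : TensorAlgebra K 𝔤) :
    coproduct K 𝔤 (mkAlgHom K 𝔤 w) = Algebra.TensorProduct.map (mkAlgHom K 𝔤) (mkAlgHom K 𝔤)
      (TensorAlgebra.unshuffle K 𝔤 w) := by
  suffices h : (coproduct K 𝔤).comp (mkAlgHom K 𝔤) =
      (Algebra.TensorProduct.map (mkAlgHom K 𝔤) (mkAlgHom K 𝔤)).comp
        (TensorAlgebra.unshuffle K 𝔤) from DFunLike.congr_fun h w
  refine TensorAlgebra.hom_ext (LinearMap.ext fun x => ?_)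
  have h := coproduct_ι K x
  rw [ι_apply] at h
  simp [h, TensorAlgebra.unshuffle_ι]

theorem mkAlgHom_adamsTwo (w : TensorAlgebra K 𝔤) :
    mkAlgHom K 𝔤 (TensorAlgebra.adamsTwo K 𝔤 w) =
      LinearMap.mul' K _ (coproduct K 𝔤 (mkAlgHom K 𝔤 w)) := by
  rw [coproduct_mkAlgHom, TensorAlgebra.adamsTwo, LinearMap.comp_apply, AlgHom.toLinearMap_apply]
  induction TensorAlgebra.unshuffle K 𝔤 w using TensorProduct.induction_on with
  | zero => simp
  | tmul a b => simp
  | add a b ha hb => simp only [map_add, ha, hb]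

theorem mkAlgHom_adamsTwo_of_mem_range {w : TensorAlgebra K 𝔤}
    (hw : mkAlgHom K 𝔤 w ∈ Set.range (ι K)) :
    mkAlgHom K 𝔤 (TensorAlgebra.adamsTwo K 𝔤 w) = (2 : ℕ) • mkAlgHom K 𝔤 w := by
  obtain ⟨x, hx⟩ := hw
  rw [mkAlgHom_adamsTwo, ← hx, coproduct_ι]
  simp [two_smul]

end UniversalEnvelopingAlgebra

open UniversalEnvelopingAlgebra in
theorem toTensorAlgebra_mem_lieElements {K : Type*} [CommRing K] [Algebra ℚ K] {𝔤 : Type*}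
    [LieRing 𝔤] [LieAlgebra K 𝔤] (n : ℕ) (W : Submodule K (⨂[K]^n 𝔤))
    (hWperm : ∀ σ : Equiv.Perm (Fin n), ∀ t ∈ W, PiTensorProduct.reindex K (fun _ => 𝔤) σ t ∈ W)
    (hWinj : Function.Injective ((tensorPowerToEnveloping K 𝔤 n).domRestrict W))
    (P : ⨂[K]^n 𝔤) (hPW : P ∈ W) (hPLie : tensorPowerToEnveloping K 𝔤 n P ∈ Set.range (ι K)) :
    TensorPower.toTensorAlgebra P ∈ TensorAlgebra.lieElements K 𝔤 := by
  let _ : Module ℚ 𝔤 := Module.compHom 𝔤 (algebraMap ℚ K)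
  have _ : IsScalarTower ℚ K 𝔤 := IsScalarTower.of_algebraMap_smul fun _ _ => rfl
  obtain ⟨ψ, h1, h2⟩ := TensorAlgebra.exists_end_toTensorAlgebra_eq_adamsTwo (K := K) (V := 𝔤) n
  -- Both sides lie in `W` and have the same image in the enveloping algebra.
  have hψ : ψ P = (2 : ℕ) • P := by
    have h := @hWinj ⟨ψ P, h1 W hWperm P hPW⟩ ⟨(2 : ℕ) • P, nsmul_mem hPW 2⟩ (by
      simp only [LinearMap.domRestrict_apply, map_nsmul]
      simp only [tensorPowerToEnveloping, LinearMap.comp_apply, AlgHom.toLinearMap_apply] at hPLie ⊢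
      rw [h2, mkAlgHom_adamsTwo_of_mem_range K hPLie])
    exact congrArg Subtype.val h
  refine TensorAlgebra.mem_lieElements_of_adamsTwo_eq ?_
  rw [← h2, hψ, map_nsmul]

/-! ### Euler derivation and iterated brackets -/

namespace TensorAlgebra

variable (K V : Type*) [CommRing K] [AddCommGroup V] [Module K V]

/-- The Euler derivation, multiplying tensors of degree `n` by `n`, packaged as an algebra
homomorphism to the dual numbers. -/
noncomputable def eulerHom :
    TensorAlgebra K V →ₐ[K] TrivSqZeroExt (TensorAlgebra K V) (TensorAlgebra K V) :=
  lift K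
    { toFun v := TrivSqZeroExt.inl (ι K v) + TrivSqZeroExt.inr (ι K v)
      map_add' v w := by ext <;> simp
      map_smul' c v := by ext <;> simp }

/-- The Euler derivation, multiplying tensors of degree `n` by `n`. -/
noncomputable def euler : TensorAlgebra K V →ₗ[K] TensorAlgebra K V where
  toFun w := (eulerHom K V w).snd
  map_add' v w := by simp
  map_smul' c v := by simp

/-- The action of the tensor algebra which computes left-iterated brackets. -/
noncomputable def leftBracketHom :
    TensorAlgebra K V →ₐ[K] Module.End K (TensorAlgebra K V × K) :=
  -- The scalar coordinate marks the empty word: from `(0, 1)` the first letter to act gives itself,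
  -- and later ones act by brackets.
  lift K (LinearMap.mk₂ K (fun v z => (⁅ι K v, z.1⁆ + z.2 • ι K v, (0 : K)))
    (fun v w z => by ext <;> simp [smul_add]; abel)
    (fun c v z => by ext <;> simp [smul_comm c z.2])
    (fun v z w => by ext <;> simp [add_smul]; abel)
    (fun c v z => by ext <;> simp [mul_smul]))

/-- The action of the opposite of the tensor algebra which computes right-iterated brackets. -/
noncomputable def rightBracketHom :
    TensorAlgebra K V →ₐ[K] (Module.End K (TensorAlgebra K V × K))ᵐᵒᵖ :=
  lift K ((MulOpposite.opLinearEquiv K).toLinearMap ∘ₗ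
    LinearMap.mk₂ K (fun v z => (⁅z.1, ι K v⁆ + z.2 • ι K v, (0 : K)))
      (fun v w z => by ext <;> simp [smul_add]; abel)
      (fun c v z => by ext <;> simp [smul_comm c z.2, LieAlgebra.lie_smul])
      (fun v z w => by ext <;> simp [add_smul]; abel)
      (fun c v z => by ext <;> simp [mul_smul]))

/-- The right-iterated bracket as a linear map, sending `x₁ ⋯ xₙ` to `[[…[x₁, x₂], …], xₙ]`. -/
noncomputable def rightBracket : TensorAlgebra K V →ₗ[K] TensorAlgebra K V where
  toFun w := ((rightBracketHom K V w).unop (0, 1)).1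
  map_add' v w := by simp
  map_smul' c v := by simp

/-- The action of the tensor algebra which computes `splitBracket`. -/
noncomputable def splitBracketHom : TensorAlgebra K V →ₐ[K]
    Module.End K ((TensorAlgebra K V ⊗[K] TensorAlgebra K V) × TensorAlgebra K V) :=
  lift K (LinearMap.mk₂ K
    -- The second coordinate keeps the suffix read so far: a new letter either extends the left part
    -- of an existing cut, or is itself the left part of a new one.
    (fun v z => ((LieAlgebra.ad K (TensorAlgebra K V) (ι K v)).rTensor (TensorAlgebra K V) z.1 +
      ι K v ⊗ₜ[K] rightBracket K V z.2, ι K v * z.2))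
    (fun v w z => by ext <;> simp [TensorProduct.add_tmul, LinearMap.rTensor_add, add_mul]; abel)
    (fun c v z => by ext <;> simp [LinearMap.rTensor_smul, TensorProduct.smul_tmul'])
    (fun v z w => by ext <;> simp [TensorProduct.tmul_add, mul_add]; abel)
    (fun c v z => by ext <;> simp))

/-- The linear map sending `x₁ ⋯ xₙ` to the sum over `p` of the tensor products of
the left-iterated bracket of `x₁, …, xₚ` and the right-iterated bracket of `xₚ₊₁, …, xₙ`. -/
noncomputable def splitBracket :
    TensorAlgebra K V →ₗ[K] TensorAlgebra K V ⊗[K] TensorAlgebra K V where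
  toFun w := (splitBracketHom K V w (0, 1)).1
  map_add' v w := by simp
  map_smul' c v := by simp

/-- The commutator of an associative algebra as a linear map on the tensor square. -/
noncomputable def commutator : TensorAlgebra K V ⊗[K] TensorAlgebra K V →ₗ[K] TensorAlgebra K V :=
  TensorProduct.lift (LieAlgebra.ad K (TensorAlgebra K V)).toLinearMap

variable {K V}

theorem eulerHom_fst (w : TensorAlgebra K V) : (eulerHom K V w).fst = w := by
  suffices h : (TrivSqZeroExt.fstHom K (TensorAlgebra K V) (TensorAlgebra K V)).comp
      (eulerHom K V) = AlgHom.id K _ from DFunLike.congr_fun h w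
  ext v
  simp [eulerHom]

theorem euler_ι (v : V) : euler K V (ι K v) = ι K v := by simp [euler, eulerHom]

theorem euler_mul (u w : TensorAlgebra K V) :
    euler K V (u * w) = u * euler K V w + euler K V u * w := by
  simp [euler, eulerHom_fst]

theorem euler_lie (u w : TensorAlgebra K V) :
    euler K V ⁅u, w⁆ = ⁅u, euler K V w⁆ + ⁅euler K V u, w⁆ := by
  simp only [LieRing.of_associative_ring_bracket, map_sub, euler_mul]
  abel

theorem euler_list_prod (l : List V) :
    euler K V (l.map (ι K)).prod = l.length • (l.map (ι K)).prod := by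
  induction l with
  | nil => simp [euler]
  | cons v l ih =>
    rw [List.map_cons, List.prod_cons, euler_mul, ih, euler_ι, List.length_cons, add_smul, one_smul,
      mul_smul_comm]

theorem leftBracketHom_ι_apply (v : V) (z : TensorAlgebra K V × K) :
    leftBracketHom K V (ι K v) z = (⁅ι K v, z.1⁆ + z.2 • ι K v, 0) := by
  simp [leftBracketHom]

theorem rightBracketHom_ι_apply (v : V) (z : TensorAlgebra K V × K) :
    (rightBracketHom K V (ι K v)).unop z = (⁅z.1, ι K v⁆ + z.2 • ι K v, 0) := by
  simp [rightBracketHom]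

theorem splitBracketHom_ι_apply (v : V)
    (z : (TensorAlgebra K V ⊗[K] TensorAlgebra K V) × TensorAlgebra K V) :
    splitBracketHom K V (ι K v) z =
      ((LieAlgebra.ad K (TensorAlgebra K V) (ι K v)).rTensor (TensorAlgebra K V) z.1 +
        ι K v ⊗ₜ[K] rightBracket K V z.2, ι K v * z.2) := by
  simp [splitBracketHom]

/-- This is the Dynkin–Specht–Wever theorem, at `z = (0, 1)`; general `z` makes the induction over
brackets work. -/
theorem leftBracketHom_apply_of_mem_lieElements {w : TensorAlgebra K V}
    (hw : w ∈ lieElements K V) (z : TensorAlgebra K V × K) :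
    leftBracketHom K V w z = (⁅w, z.1⁆ + z.2 • euler K V w, 0) := by
  induction hw using LieSubalgebra.lieSpan_induction generalizing z with
  | mem x h => obtain ⟨v, rfl⟩ := h; rw [euler_ι, leftBracketHom_ι_apply]
  | zero => ext <;> simp
  | add x y _ _ hx hy => ext <;> simp [hx, hy]; abel
  | smul c x _ hx => ext <;> simp [hx, smul_comm c z.2]
  | lie x y hx' hy' hx hy =>
    have h : leftBracketHom K V ⁅x, y⁆ z = leftBracketHom K V x (leftBracketHom K V y z) -
        leftBracketHom K V y (leftBracketHom K V x z) := by
      rw [LieRing.of_associative_ring_bracket, map_sub, map_mul, map_mul]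
      rfl
    rw [h]
    ext
    · simp only [hx, hy, euler_lie, Prod.fst_sub,
        lie_add, LieAlgebra.lie_smul, smul_add, zero_smul, add_zero, lie_lie]
      rw [← lie_skew y (euler K V x)]
      simp only [smul_neg]
      abel
    · simp [hx, hy]

theorem rightBracketHom_apply_of_mem_lieElements {w : TensorAlgebra K V}
    (hw : w ∈ lieElements K V) (z : TensorAlgebra K V × K) :
    (rightBracketHom K V w).unop z = (⁅z.1, w⁆ + z.2 • euler K V w, 0) := by
  induction hw using LieSubalgebra.lieSpan_induction generalizing z with
  | mem x h => obtain ⟨v, rfl⟩ := h; rw [euler_ι, rightBracketHom_ι_apply]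
  | zero => ext <;> simp
  | add x y _ _ hx hy => ext <;> simp [hx, hy]; abel
  | smul c x _ hx => ext <;> simp [hx, smul_comm c z.2]
  | lie x y hx' hy' hx hy =>
    have h : (rightBracketHom K V ⁅x, y⁆).unop z =
        (rightBracketHom K V y).unop ((rightBracketHom K V x).unop z) -
          (rightBracketHom K V x).unop ((rightBracketHom K V y).unop z) := by
      rw [LieRing.of_associative_ring_bracket, map_sub, map_mul, map_mul]
      rfl
    rw [h]
    ext
    · simp only [hx, hy, euler_lie, Prod.fst_sub,
        add_lie, smul_lie, smul_add, zero_smul, add_zero, leibniz_lie z.1 x y]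
      rw [← lie_skew x (⁅z.1, y⁆), ← lie_skew x (euler K V y)]
      simp only [smul_neg]
      abel
    · simp [hx, hy]

theorem rightBracket_mul_of_mem_lieElements (u : TensorAlgebra K V) {s : TensorAlgebra K V}
    (hs : s ∈ lieElements K V) :
    rightBracket K V (u * s) = ⁅rightBracket K V u, s⁆ +
      ((rightBracketHom K V u).unop (0, 1)).2 • euler K V s := by
  simp [rightBracket, rightBracketHom_apply_of_mem_lieElements hs]

theorem splitBracketHom_apply_zero_mul (v : V) (u s : TensorAlgebra K V) :
    splitBracketHom K V (ι K v * u) (0, s) = splitBracketHom K V (ι K v)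
      (splitBracketHom K V u (0, s)) := by
  rw [map_mul]
  rfl

theorem splitBracketHom_apply_snd (u : TensorAlgebra K V)
    (z : (TensorAlgebra K V ⊗[K] TensorAlgebra K V) × TensorAlgebra K V) :
    (splitBracketHom K V u z).2 = u * z.2 := by
  induction u using TensorAlgebra.induction generalizing z with
  | algebraMap r => simp [Algebra.algebraMap_eq_smul_one]
  | ι v => rw [splitBracketHom_ι_apply]
  | mul a b ha hb => rw [map_mul, Module.End.mul_apply, ha, hb, mul_assoc]
  | add a b ha hb => rw [map_add, LinearMap.add_apply, Prod.snd_add, ha, hb, add_mul]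

theorem splitBracket_mul_eq (u w : TensorAlgebra K V) :
    splitBracket K V (u * w) = (splitBracketHom K V u (splitBracket K V w, w)).1 := by
  have h : splitBracketHom K V w (0, 1) = (splitBracket K V w, w) :=
    Prod.ext rfl (by rw [splitBracketHom_apply_snd, mul_one])
  rw [← h, splitBracket, LinearMap.coe_mk, AddHom.coe_mk, map_mul, Module.End.mul_apply]

theorem splitBracket_ι_mul (v : V) (w : TensorAlgebra K V) :
    splitBracket K V (ι K v * w) =
      (LieAlgebra.ad K (TensorAlgebra K V) (ι K v)).rTensor (TensorAlgebra K V)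
        (splitBracket K V w) + ι K v ⊗ₜ[K] rightBracket K V w := by
  rw [splitBracket_mul_eq, splitBracketHom_ι_apply]

theorem rightBracket_one : rightBracket K V 1 = 0 := by simp [rightBracket]

theorem splitBracket_one : splitBracket K V 1 = 0 := by simp [splitBracket]

theorem leftBracketHom_ι_mul_one_fst (v : V) (u : TensorAlgebra K V) :
    (leftBracketHom K V (ι K v * u) (0, 1)).1 = ⁅ι K v, (leftBracketHom K V u (0, 1)).1⁆ +
      (leftBracketHom K V u (0, 1)).2 • ι K v := by
  rw [map_mul, Module.End.mul_apply, leftBracketHom_ι_apply]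

theorem leftBracketHom_snd_eq_rightBracketHom_snd (u : TensorAlgebra K V) :
    (leftBracketHom K V u (0, 1)).2 = ((rightBracketHom K V u).unop (0, 1)).2 := by
  -- Both scalar coordinates are multiplied by the augmentation of `u`.
  have hl : ∀ (u : TensorAlgebra K V) z, (leftBracketHom K V u z).2 = algebraMapInv u * z.2 := by
    intro u
    induction u using TensorAlgebra.induction with
    | algebraMap r => simp [Algebra.algebraMap_eq_smul_one]
    | ι v => intro z; rw [leftBracketHom_ι_apply]; simp [algebraMapInv]
    | mul a b ha hb => intro z; rw [map_mul, Module.End.mul_apply, ha, hb, map_mul, mul_assoc]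
    | add a b ha hb =>
      intro z; rw [map_add, LinearMap.add_apply, Prod.snd_add, ha, hb, map_add, add_mul]
  have hr : ∀ (u : TensorAlgebra K V) z,
      ((rightBracketHom K V u).unop z).2 = algebraMapInv u * z.2 := by
    intro u
    induction u using TensorAlgebra.induction with
    | algebraMap r => simp [Algebra.algebraMap_eq_smul_one]
    | ι v => intro z; rw [rightBracketHom_ι_apply]; simp [algebraMapInv]
    | mul a b ha hb =>
      intro z
      rw [map_mul, MulOpposite.unop_mul, Module.End.mul_apply, hb, ha, map_mul]
      ring
    | add a b ha hb =>
      intro z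
      rw [map_add, MulOpposite.unop_add, LinearMap.add_apply, Prod.snd_add, ha, hb, map_add,
        add_mul]
  rw [hl, hr]

/-- These are the cuts of `u * s` whose left part ends within `u`. The cut just before `s` gives the
Euler term; any earlier one brackets its right part with `s`. -/
theorem splitBracketHom_apply_zero_fst (u : TensorAlgebra K V) {s : TensorAlgebra K V}
    (hs : s ∈ lieElements K V) :
    (splitBracketHom K V u (0, s)).1 =
      (leftBracketHom K V u (0, 1)).1 ⊗ₜ[K] euler K V s -
        (LieAlgebra.ad K (TensorAlgebra K V) s).lTensor (TensorAlgebra K V)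
          (splitBracket K V u) := by
  let f : TensorAlgebra K V →ₗ[K] TensorAlgebra K V ⊗[K] TensorAlgebra K V :=
    { toFun u := (splitBracketHom K V u (0, s)).1 - ((leftBracketHom K V u (0, 1)).1 ⊗ₜ[K]
        euler K V s - (LieAlgebra.ad K (TensorAlgebra K V) s).lTensor (TensorAlgebra K V)
          (splitBracket K V u))
      map_add' u w := by simp [TensorProduct.add_tmul]; abel
      map_smul' c w := by simp [TensorProduct.smul_tmul', smul_sub] }
  suffices h : LinearMap.ker f = ⊤ from
    sub_eq_zero.1 (LinearMap.mem_ker.1 (h ▸ Submodule.mem_top : u ∈ LinearMap.ker f))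
  refine eq_top_of_one_mem_of_ι_mul_mem _ (by simp [f, splitBracket_one]) fun v u hu => ?_
  have hu : (splitBracketHom K V u (0, s)).1 = (leftBracketHom K V u (0, 1)).1 ⊗ₜ[K]
      euler K V s - (LieAlgebra.ad K (TensorAlgebra K V) s).lTensor (TensorAlgebra K V)
        (splitBracket K V u) := sub_eq_zero.1 hu
  refine sub_eq_zero.2 ?_
  rw [splitBracketHom_apply_zero_mul, splitBracketHom_ι_apply, splitBracketHom_apply_snd,
    rightBracket_mul_of_mem_lieElements u hs, hu, splitBracket_ι_mul, leftBracketHom_ι_mul_one_fst,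
    leftBracketHom_snd_eq_rightBracketHom_snd, ← lie_skew (rightBracket K V u) s]
  simp only [map_sub, map_add, LinearMap.rTensor_tmul, LinearMap.lTensor_tmul, LieAlgebra.ad_apply,
    TensorProduct.add_tmul, TensorProduct.tmul_add, TensorProduct.tmul_neg,
    TensorProduct.tmul_smul, ← TensorProduct.smul_tmul']
  rw [← LinearMap.comp_apply (LinearMap.rTensor _ _) (LinearMap.lTensor _ _),
    ← LinearMap.comp_apply (LinearMap.lTensor _ _) (LinearMap.rTensor _ _),
    LinearMap.rTensor_comp_lTensor, LinearMap.lTensor_comp_rTensor]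
  abel

theorem splitBracketHom_apply_fst_of_mem_lieElements {u s : TensorAlgebra K V}
    (hu : u ∈ lieElements K V) (z : TensorAlgebra K V ⊗[K] TensorAlgebra K V) :
    (splitBracketHom K V u (z, s)).1 =
      (LieAlgebra.ad K (TensorAlgebra K V) u).rTensor (TensorAlgebra K V) z +
        (splitBracketHom K V u (0, s)).1 := by
  have hz : (z, s) = (z, 0) + (0, s) := by simp
  rw [hz, map_add, Prod.fst_add]
  congr 1
  clear hz
  induction hu using LieSubalgebra.lieSpan_induction generalizing z with
  | mem x h => obtain ⟨v, rfl⟩ := h; rw [splitBracketHom_ι_apply]; simp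
  | zero => simp
  | add x y _ _ hx hy => simp [hx, hy, LinearMap.rTensor_add]
  | smul c x _ hx => simp [hx, LinearMap.rTensor_smul]
  | lie x y _ _ hx hy =>
    have hpair : ∀ (w : TensorAlgebra K V) (z : TensorAlgebra K V ⊗[K] TensorAlgebra K V),
        splitBracketHom K V w (z, 0) = ((splitBracketHom K V w (z, 0)).1, 0) := fun w z =>
      Prod.ext rfl (by rw [splitBracketHom_apply_snd, mul_zero])
    have h : splitBracketHom K V ⁅x, y⁆ (z, 0) =
        splitBracketHom K V x (splitBracketHom K V y (z, 0)) -
          splitBracketHom K V y (splitBracketHom K V x (z, 0)) := by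
      rw [LieRing.of_associative_ring_bracket, map_sub, map_mul, map_mul]
      rfl
    rw [h, hpair y, hpair x z, Prod.fst_sub, hx, hy, hx, hy, LieHom.map_lie,
      LieRing.of_associative_ring_bracket, LinearMap.rTensor_sub, LinearMap.rTensor_mul,
      LinearMap.rTensor_mul]
    rfl

theorem commutator_tmul (a b : TensorAlgebra K V) : commutator K V (a ⊗ₜ[K] b) = ⁅a, b⁆ := rfl

theorem commutator_rTensor_add_lTensor (u : TensorAlgebra K V)
    (z : TensorAlgebra K V ⊗[K] TensorAlgebra K V) :
    commutator K V ((LieAlgebra.ad K (TensorAlgebra K V) u).rTensor (TensorAlgebra K V) z) +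
      commutator K V ((LieAlgebra.ad K (TensorAlgebra K V) u).lTensor (TensorAlgebra K V) z) =
        ⁅u, commutator K V z⁆ := by
  induction z using TensorProduct.induction_on with
  | zero => simp
  | tmul a b =>
    simp only [LinearMap.rTensor_tmul, LinearMap.lTensor_tmul, commutator_tmul, LieAlgebra.ad_apply,
      leibniz_lie u a b]
  | add a b ha hb =>
    simp only [map_add, lie_add, ← ha, ← hb]
    abel

/-- On Lie elements, the sum of the brackets of left-iterated and right-iterated brackets over all
the ways of cutting a tensor into two parts is `D (D - 1)`, where `D` is the Euler derivation. -/
theorem commutator_splitBracket_of_mem_lieElements {w : TensorAlgebra K V}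
    (hw : w ∈ lieElements K V) :
    commutator K V (splitBracket K V w) = euler K V (euler K V w) - euler K V w := by
  induction hw using LieSubalgebra.lieSpan_induction with
  | mem x h =>
    obtain ⟨v, rfl⟩ := h
    rw [euler_ι, euler_ι, sub_self, ← mul_one (ι K v), splitBracket_ι_mul, splitBracket_one,
      rightBracket_one]
    simp
  | zero => simp
  | add x y _ _ hx hy => simp only [map_add, hx, hy]; abel
  | smul c x _ hx => simp only [map_smul, hx, smul_sub]
  | lie x y hx' hy' hx hy =>
    -- Antisymmetrizing this in `u` and `s` pairs the `rTensor` and `lTensor` terms into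
    -- derivations, and the Euler terms yield the cross term `2 ⁅D x, D y⁆` of `D ^ 2`.
    have key : ∀ u ∈ lieElements K V, ∀ s ∈ lieElements K V, splitBracket K V (u * s) =
        (LieAlgebra.ad K (TensorAlgebra K V) u).rTensor (TensorAlgebra K V) (splitBracket K V s) +
          (euler K V u ⊗ₜ[K] euler K V s -
            (LieAlgebra.ad K (TensorAlgebra K V) s).lTensor (TensorAlgebra K V)
              (splitBracket K V u)) := by
      intro u hu s hs
      rw [splitBracket_mul_eq, splitBracketHom_apply_fst_of_mem_lieElements hu,
        splitBracketHom_apply_zero_fst u hs, leftBracketHom_apply_of_mem_lieElements hu]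
      simp
    have h1 := commutator_rTensor_add_lTensor x (splitBracket K V y)
    have h2 := commutator_rTensor_add_lTensor y (splitBracket K V x)
    rw [hy] at h1
    rw [hx] at h2
    have h3 : commutator K V (splitBracket K V ⁅x, y⁆) =
        ⁅x, euler K V (euler K V y) - euler K V y⁆ - ⁅y, euler K V (euler K V x) - euler K V x⁆ +
          (⁅euler K V x, euler K V y⁆ - ⁅euler K V y, euler K V x⁆) := by
      rw [← h1, ← h2, LieRing.of_associative_ring_bracket, map_sub, key x hx' y hy', key y hy' x hx']
      simp only [map_sub, map_add, commutator_tmul]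
      abel
    rw [h3, euler_lie, map_add, euler_lie, euler_lie]
    simp only [LieRing.of_associative_ring_bracket]
    noncomm_ring

/-! ### Evaluation on words and passage to the enveloping algebra -/

theorem rightBracketHom_list_prod_apply (l : List V) (z : TensorAlgebra K V) :
    (rightBracketHom K V (l.map (ι K)).prod).unop (z, 0) =
      ((l.map (ι K)).foldl (fun u v => ⁅u, v⁆) z, 0) := by
  induction l generalizing z with
  | nil => simp
  | cons v l ih =>
    rw [List.map_cons, List.prod_cons, map_mul, MulOpposite.unop_mul, Module.End.mul_apply,
      rightBracketHom_ι_apply, zero_smul, add_zero, ih, List.foldl_cons]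

theorem rightBracket_list_prod (l : List V) :
    rightBracket K V (l.map (ι K)).prod = lieBracketR (l.map (ι K)) := by
  cases l with
  | nil => simp [rightBracket_one, lieBracketR]
  | cons v l =>
    rw [rightBracket, LinearMap.coe_mk, AddHom.coe_mk, List.map_cons, List.prod_cons, map_mul,
      MulOpposite.unop_mul, Module.End.mul_apply, rightBracketHom_ι_apply, zero_lie, one_smul,
      zero_add, rightBracketHom_list_prod_apply, lieBracketR]

theorem splitBracket_list_prod (l : List V) :
    splitBracket K V (l.map (ι K)).prod = ∑ p ∈ Finset.Ico 1 l.length,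
      lieBracketL ((l.take p).map (ι K)) ⊗ₜ[K] lieBracketR ((l.drop p).map (ι K)) := by
  induction l with
  | nil => simp [splitBracket_one]
  | cons v l ih =>
    rw [List.map_cons, List.prod_cons, splitBracket_ι_mul, ih, rightBracket_list_prod,
      List.length_cons]
    cases l with
    -- No cut is counted after the last letter, as the right bracket of the empty word is `0`.
    | nil => simp [lieBracketR]
    | cons w l =>
      rw [Finset.sum_eq_sum_Ico_succ_bot (by simp : 1 < (w :: l).length + 1),
        ← Finset.sum_Ico_add' _ 1 (w :: l).length 1, map_sum, add_comm]
      congr 1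
      refine Finset.sum_congr rfl fun p hp => ?_
      obtain ⟨q, rfl⟩ : ∃ q, p = q + 1 := ⟨p - 1, by have := (Finset.mem_Ico.1 hp).1; omega⟩
      simp [lieBracketL]

end TensorAlgebra

theorem map_lieBracketL {K L L' : Type*} [CommRing K] [LieRing L] [LieAlgebra K L] [LieRing L']
    [LieAlgebra K L'] (f : L →ₗ⁅K⁆ L') (l : List L) :
    f (lieBracketL l) = lieBracketL (l.map f) := by
  induction l with
  | nil => simp [lieBracketL]
  | cons x l ih =>
    cases l with
    | nil => simp [lieBracketL]
    | cons y l => simpa [lieBracketL] using congrArg (fun z => ⁅f x, z⁆) ih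

theorem map_lieBracketR {K L L' : Type*} [CommRing K] [LieRing L] [LieAlgebra K L] [LieRing L']
    [LieAlgebra K L'] (f : L →ₗ⁅K⁆ L') (l : List L) :
    f (lieBracketR l) = lieBracketR (l.map f) := by
  cases l with
  | nil => simp [lieBracketR]
  | cons x l =>
    simp only [lieBracketR, List.map_cons]
    induction l generalizing x with
    | nil => simp
    | cons y l ih => simpa using ih ⁅x, y⁆

open UniversalEnvelopingAlgebra in
theorem mkAlgHom_commutator_splitBracket {K 𝔤 : Type*} [CommRing K] [LieRing 𝔤] [LieAlgebra K 𝔤]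
    (l : List 𝔤) :
    mkAlgHom K 𝔤 (TensorAlgebra.commutator K 𝔤 (TensorAlgebra.splitBracket K 𝔤
      (l.map (TensorAlgebra.ι K)).prod)) =
        ι K (∑ p ∈ Finset.Ico 1 l.length, ⁅lieBracketL (l.take p), lieBracketR (l.drop p)⁆) := by
  have hmap : ∀ l : List 𝔤,
      (l.map (TensorAlgebra.ι K)).map (mkAlgHom K 𝔤 : TensorAlgebra K 𝔤 →ₗ⁅K⁆ _) =
        l.map (ι K) := fun l => by simp [Function.comp_def]
  rw [TensorAlgebra.splitBracket_list_prod, map_sum, map_sum, map_sum]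
  refine Finset.sum_congr rfl fun p _ => ?_
  rw [TensorAlgebra.commutator_tmul, LieHom.map_lie, map_lieBracketL, map_lieBracketR, ← hmap,
    ← hmap, ← map_lieBracketL, ← map_lieBracketR, ← LieHom.map_lie]
  rfl

end FreeLieElements

theorem mainTheorem8 {K : Type*} [CommRing K] [Algebra ℚ K] {𝔤 : Type*} [LieRing 𝔤]
    [LieAlgebra K 𝔤] (n : ℕ) (W : Submodule K (⨂[K]^n 𝔤))
    (hWperm : ∀ σ : Equiv.Perm (Fin n), ∀ t ∈ W, PiTensorProduct.reindex K (fun _ => 𝔤) σ t ∈ W)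
    (hWinj : Function.Injective ((tensorPowerToEnveloping K 𝔤 n).domRestrict W))
    {Λ : Type*} [Fintype Λ] (a : Λ → Fin n → 𝔤) (P : ⨂[K]^n 𝔤)
    (hP : P = ∑ l, PiTensorProduct.tprod K (a l)) (hPW : P ∈ W)
    (hPLie : tensorPowerToEnveloping K 𝔤 n P ∈ Set.range (UniversalEnvelopingAlgebra.ι K)) :
    ((n : K) * ((n : K) - 1)) • tensorPowerToEnveloping K 𝔤 n P =
      UniversalEnvelopingAlgebra.ι K
        (∑ l, ∑ p ∈ Finset.Ico 1 n,
          ⁅lieBracketL ((List.ofFn (a l)).take p), lieBracketR ((List.ofFn (a l)).drop p)⁆) := by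
  have hmem := toTensorAlgebra_mem_lieElements n W hWperm hWinj P hPW hPLie
  have hsum : TensorPower.toTensorAlgebra P =
      ∑ l, ((List.ofFn (a l)).map (TensorAlgebra.ι K)).prod := by
    rw [hP, map_sum]
    refine Finset.sum_congr rfl fun l _ => ?_
    rw [TensorPower.toTensorAlgebra_tprod, TensorAlgebra.tprod_apply, List.map_ofFn]
    rfl
  have heuler : TensorAlgebra.euler K 𝔤 (TensorPower.toTensorAlgebra P) =
      (n : K) • TensorPower.toTensorAlgebra P := by
    rw [hsum, map_sum, Finset.smul_sum]
    refine Finset.sum_congr rfl fun l _ => ?_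
    rw [TensorAlgebra.euler_list_prod, List.length_ofFn, Nat.cast_smul_eq_nsmul]
  have key := TensorAlgebra.commutator_splitBracket_of_mem_lieElements hmem
  rw [heuler, map_smul, heuler, smul_smul, ← sub_smul] at key
  have hcoef : (n : K) * ((n : K) - 1) = (n : K) * n - n := by ring
  rw [hcoef, tensorPowerToEnveloping, LinearMap.comp_apply, AlgHom.toLinearMap_apply, ← map_smul,
    ← key, hsum, map_sum, map_sum, map_sum, map_sum]
  refine Finset.sum_congr rfl fun l _ => ?_
  rw [mkAlgHom_commutator_splitBracket, List.length_ofFn]
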